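/- Let $N\ge 1$. Let $\mathcal{D}=\mathrm{Der}\,\mathbb{C}[t_1^{\pm1},\dots,t_{N+1}^{\pm1}]$ be the Lie algebra of polynomial vector fields on the $(N+1)$-dimensional torus. Put $d_j=t_j\frac{\partial}{\partial t_j}$ and $D(u,r)=\sum_{j=1}^{N+1}u_j t^r d_j$ for $u\in\mathbb{C}^{N+1}$, $r\in\mathbb{Z}^{N+1}$, and let $\mathcal{D}_{\mathrm{div}}\subset\mathcal{D}$ be the Lie subalgebra of vector fields $\sum_j f_j d_j$ of divergence zero, i.e. with $\sum_j d_j(f_j)=0$; it is spanned by the $D(u,r)$ with $(u|r)=u^Tr=0$. Let $\omega_1,\dots,\omega_N$ be the fundamental weights of $\mathfrak{sl}_{N+1}(\mathbb{C})$, let $\lambda=C_1\omega_1+\dots+C_N\omega_N$ ($C_i\in\mathbb{Z}_{\ge0}$) be a dominant weight, and let $V(\lambda)$ be the finite-dimensional irreducible $\mathfrak{sl}_{N+1}(\mathbb{C})$-module of highest weight $\lambda$. For $\sigma\in\mathbb{C}^{N+1}$ let $F^{\sigma}(\lambda)=V(\lambda)\otimes\mathbb{C}[q_1^{\pm1},\dots,q_{N+1}^{\pm1}]$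 be the $\mathcal{D}_{\mathrm{div}}$-module with action \[D(u,r).(v\otimes q^n)=(u|n+\sigma)\,v\otimes q^{n+r}+\big((ru^T)v\big)\otimes q^{n+r}\] for $v\in V(\lambda)$, $n\in\mathbb{Z}^{N+1}$ and $(u|r)=0$, where the matrix $ru^T$ has trace zero and so acts on $V(\lambda)$ as an element of $\mathfrak{sl}_{N+1}(\mathbb{C})$. If $\lambda\neq0$ and $\lambda\neq\omega_k$ for every $k\in\{1,\dots,N\}$, then $F^{\sigma}(\lambda)$ is irreducible as a $\mathcal{D}_{\mathrm{div}}$-module for every $\sigma\in\mathbb{C}^{N+1}$. -/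

import Mathlib

open scoped TensorProduct Matrix

noncomputable section

namespace TorusFields

open LieAlgebra.SpecialLinear

attribute [local instance 100] LieRing.ofAssociativeRing

/-! ### Laurent polynomials and derivations -/

/-- The algebra `A = ℂ[t₁^{±1}, …, t_{N+1}^{±1}]` of Laurent polynomials in `N + 1` variables, as the
group algebra of `ℤ^{N+1}`. -/
abbrev Laurent (N : ℕ) : Type := AddMonoidAlgebra ℂ (Fin (N + 1) → ℤ)

/-- The monomial `t^r = t₁^{r₁} ⋯ t_{N+1}^{r_{N+1}}`. -/
def mono {N : ℕ} (r : Fin (N + 1) → ℤ) : Laurent N := AddMonoidAlgebra.single r 1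

/-- The inclusion `ℤ^{N+1} ⊆ ℂ^{N+1}`. -/
def toC {N : ℕ} (r : Fin (N + 1) → ℤ) : Fin (N + 1) → ℂ := fun j => (r j : ℂ)

@[simp] lemma toC_apply {N : ℕ} (r : Fin (N + 1) → ℤ) (j : Fin (N + 1)) :
    toC r j = (r j : ℂ) := rfl

@[simp] lemma toC_add {N : ℕ} (r s : Fin (N + 1) → ℤ) : toC (r + s) = toC r + toC s := by
  ext j; simp

@[simp] lemma mono_mul {N : ℕ} (r s : Fin (N + 1) → ℤ) : mono r * mono s = mono (r + s) := by
  simp [mono]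

lemma mono_zero {N : ℕ} : (mono 0 : Laurent N) = 1 := rfl

lemma laurent_hom_ext {N : ℕ} {M : Type*} [AddCommGroup M] [Module ℂ M]
    {f g : Laurent N →ₗ[ℂ] M} (h : ∀ n, f (mono n) = g (mono n)) : f = g := by
  refine AddMonoidAlgebra.lhom_ext' fun n => ?_
  ext
  simpa [mono] using h n

/-- The linear map underlying `d_j`. -/
def eulerLin {N : ℕ} (j : Fin (N + 1)) : Laurent N →ₗ[ℂ] Laurent N :=
  (Finsupp.lsum ℂ fun n : Fin (N + 1) → ℤ =>
    (n j : ℂ) • (AddMonoidAlgebra.lsingle n : ℂ →ₗ[ℂ] Laurent N)) ∘ₗ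
    (AddMonoidAlgebra.coeffLinearEquiv ℂ).toLinearMap

@[simp] lemma eulerLin_mono {N : ℕ} (j : Fin (N + 1)) (n : Fin (N + 1) → ℤ) :
    eulerLin j (mono n) = (n j : ℂ) • mono n := by
  simp [eulerLin, mono]

/-- The derivation `d_j = t_j ∂/∂t_j` of `A`, that is, `t^n ↦ n_j t^n`. -/
def euler {N : ℕ} (j : Fin (N + 1)) : Derivation ℂ (Laurent N) (Laurent N) :=
  Derivation.mk' (eulerLin j) (by
    have key : (LinearMap.mul ℂ (Laurent N)).compr₂ (eulerLin j) =
        (LinearMap.mul ℂ (Laurent N)).compl₂ (eulerLin j) +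
          (LinearMap.mul ℂ (Laurent N)) ∘ₗ (eulerLin j) := by
      refine laurent_hom_ext fun m => laurent_hom_ext fun n => ?_
      simp [add_smul, add_comm]
    intro a b
    have := congrArg (fun F => F a b) key
    simpa [mul_comm] using this)

@[simp] lemma euler_mono {N : ℕ} (j : Fin (N + 1)) (n : Fin (N + 1) → ℤ) :
    euler j (mono n) = (n j : ℂ) • mono n := eulerLin_mono j n

/-- The homogeneous vector field `D(u, r) = ∑ⱼ uⱼ t^r dⱼ`. -/
def vf {N : ℕ} (u : Fin (N + 1) → ℂ) (r : Fin (N + 1) → ℤ) :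
    Derivation ℂ (Laurent N) (Laurent N) :=
  ∑ j, u j • (mono r : Laurent N) • euler j

lemma vf_mono {N : ℕ} (u : Fin (N + 1) → ℂ) (r n : Fin (N + 1) → ℤ) :
    vf u r (mono n) = (u ⬝ᵥ toC n) • mono (r + n) := by
  have h (s : Finset (Fin (N + 1))) :
      (∑ j ∈ s, u j • (mono r : Laurent N) • euler j) (mono n) =
        (∑ j ∈ s, u j * (n j : ℂ)) • mono (r + n) := by
    induction s using Finset.cons_induction with
    | empty => simp
    | cons a s ha ih =>
      rw [Finset.sum_cons, Finset.sum_cons, Derivation.add_apply, ih, add_smul]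
      simp [mul_smul]
  exact h _

lemma vf_zero {N : ℕ} (r : Fin (N + 1) → ℤ) : vf (0 : Fin (N + 1) → ℂ) r = 0 := by
  simp [vf]

/-- The `j`-th component `f_j = t_j⁻¹ X(t_j)` of a vector field `X = ∑ⱼ f_j d_j`. -/
def comp {N : ℕ} (j : Fin (N + 1)) : Derivation ℂ (Laurent N) (Laurent N) →ₗ[ℂ] Laurent N where
  toFun X := mono (-Pi.single j 1) * X (mono (Pi.single j 1))
  map_add' X Y := by simp [mul_add]
  map_smul' c X := by simp

lemma comp_apply {N : ℕ} (j : Fin (N + 1)) (X : Derivation ℂ (Laurent N) (Laurent N)) :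
    comp j X = mono (-Pi.single j 1) * X (mono (Pi.single j 1)) := rfl

lemma apply_mono {N : ℕ} (X : Derivation ℂ (Laurent N) (Laurent N)) (n : Fin (N + 1) → ℤ) :
    X (mono n) = ∑ j, (n j : ℂ) • (comp j X * mono n) := by
  let φ : (Fin (N + 1) → ℤ) →+ Laurent N :=
    { toFun := fun n => mono (-n) * X (mono n)
      map_zero' := by simp [mono_zero]
      map_add' := fun m n => by
        rw [← mono_mul, Derivation.leibniz, mul_add, smul_eq_mul, smul_eq_mul, ← mul_assoc,
          ← mul_assoc, mono_mul, mono_mul, add_comm]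
        congr 3 <;> abel }
  have h1 : φ n = ∑ j, (n j : ℂ) • comp j X := by
    conv_lhs => rw [← Finset.univ_sum_single n]
    rw [map_sum]
    refine Finset.sum_congr rfl fun j _ => ?_
    have : (Pi.single j (n j) : Fin (N + 1) → ℤ) = n j • Pi.single j 1 := by
      rw [← Pi.single_smul]; simp
    rw [this, map_zsmul, Int.cast_smul_eq_zsmul]
    rfl
  have h2 : X (mono n) = φ n * mono n := by
    change _ = mono (-n) * X (mono n) * mono n
    rw [mul_right_comm, mono_mul, neg_add_cancel, mono_zero, one_mul]
  rw [h2, h1, Finset.sum_mul]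
  simp

/-- `u_r(X) ∈ ℂ^{N+1}`, the vector of `t^r`-coefficients of the components of `X`, so that
`X = ∑_r D(u_r(X), r)`. -/
def coeffVec {N : ℕ} (r : Fin (N + 1) → ℤ) :
    Derivation ℂ (Laurent N) (Laurent N) →ₗ[ℂ] (Fin (N + 1) → ℂ) where
  toFun X := fun j => (comp j X).coeff r
  map_add' X Y := by ext; simp
  map_smul' c X := by ext; simp

/-- The finite set of degrees `r` with `u_r(X) ≠ 0`. -/
def degrees {N : ℕ} (X : Derivation ℂ (Laurent N) (Laurent N)) : Finset (Fin (N + 1) → ℤ) :=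
  Finset.univ.biUnion fun j => (comp j X).coeff.support

lemma coeffVec_eq_zero {N : ℕ} {X : Derivation ℂ (Laurent N) (Laurent N)}
    {r : Fin (N + 1) → ℤ} (h : r ∉ degrees X) : coeffVec r X = 0 := by
  ext j
  simp only [degrees, Finset.mem_biUnion, Finset.mem_univ, true_and, not_exists,
    Finsupp.mem_support_iff, not_not] at h
  exact h j

lemma comp_vf {N : ℕ} (u : Fin (N + 1) → ℂ) (r : Fin (N + 1) → ℤ) (j : Fin (N + 1)) :
    comp j (vf u r) = u j • mono r := by
  rw [comp_apply, vf_mono]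
  have : u ⬝ᵥ toC (Pi.single j 1) = u j := by
    simp [dotProduct, Pi.single_apply]
  rw [this, mul_smul_comm, mono_mul]
  congr 2
  abel

lemma coeffVec_vf_self {N : ℕ} (u : Fin (N + 1) → ℂ) (r : Fin (N + 1) → ℤ) :
    coeffVec r (vf u r) = u := by
  ext j
  change (comp j (vf u r)).coeff r = _
  simp [comp_vf, mono]

lemma coeffVec_vf_of_ne {N : ℕ} (u : Fin (N + 1) → ℂ) {r s : Fin (N + 1) → ℤ} (h : s ≠ r) :
    coeffVec s (vf u r) = 0 := by
  ext j
  change (comp j (vf u r)).coeff s = _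
  simp [comp_vf, mono, h.symm]

/-- Every vector field is the sum of its homogeneous components. -/
lemma eq_sum_vf {N : ℕ} (X : Derivation ℂ (Laurent N) (Laurent N)) :
    X = ∑ r ∈ degrees X, vf (coeffVec r X) r := by
  have hcomp (j : Fin (N + 1)) :
      comp j X = comp j (∑ r ∈ degrees X, vf (coeffVec r X) r) := by
    ext s
    rw [map_sum, AddMonoidAlgebra.coeff_sum, Finsupp.finsetSum_apply]
    have : ∀ r ∈ degrees X, (comp j (vf (coeffVec r X) r)).coeff s =
        if r = s then (comp j X).coeff s else 0 := by
      intro r _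
      rw [comp_vf]
      split_ifs with h
      · subst h; simp [mono]; rfl
      · simp [mono, h]
    rw [Finset.sum_congr rfl this, Finset.sum_ite_eq']
    split_ifs with h
    · rfl
    · exact congrFun (coeffVec_eq_zero h) j
  have : (X : Laurent N →ₗ[ℂ] Laurent N) =
      ((∑ r ∈ degrees X, vf (coeffVec r X) r : Derivation ℂ (Laurent N) (Laurent N)) :
        Laurent N →ₗ[ℂ] Laurent N) := by
    refine laurent_hom_ext fun n => ?_
    change X (mono n) = (∑ r ∈ degrees X, vf (coeffVec r X) r) (mono n)
    rw [apply_mono X n, apply_mono _ n]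
    simp_rw [← hcomp]
  exact Derivation.ext fun a => congrArg (fun F => F a) this

lemma vf_bracket {N : ℕ} (u v : Fin (N + 1) → ℂ) (r s : Fin (N + 1) → ℤ) :
    ⁅vf u r, vf v s⁆ = vf ((u ⬝ᵥ toC s) • v - (v ⬝ᵥ toC r) • u) (r + s) := by
  have : ((⁅vf u r, vf v s⁆ : Derivation ℂ (Laurent N) (Laurent N)) :
      Laurent N →ₗ[ℂ] Laurent N) =
      (vf ((u ⬝ᵥ toC s) • v - (v ⬝ᵥ toC r) • u) (r + s) : Laurent N →ₗ[ℂ] Laurent N) := by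
    refine laurent_hom_ext fun n => ?_
    change ⁅vf u r, vf v s⁆ (mono n) = vf _ _ (mono n)
    rw [Derivation.commutator_apply]
    simp only [vf_mono, Derivation.map_smul, smul_smul, toC_add, dotProduct_add, sub_dotProduct,
      smul_dotProduct, smul_eq_mul]
    rw [show r + (s + n) = r + s + n by abel, show s + (r + n) = r + s + n by abel, ← sub_smul]
    congr 1
    ring
  exact Derivation.ext fun a => congrArg (fun F => F a) this

/-! ### Divergence-zero vector fields -/

/-- The divergence `div (∑ⱼ f_j d_j) = ∑ⱼ d_j(f_j)`. -/
def divergence (N : ℕ) : Derivation ℂ (Laurent N) (Laurent N) →ₗ[ℂ] Laurent N :=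
  ∑ j, eulerLin j ∘ₗ comp j

lemma divergence_vf {N : ℕ} (u : Fin (N + 1) → ℂ) (r : Fin (N + 1) → ℤ) :
    divergence N (vf u r) = (u ⬝ᵥ toC r) • mono r := by
  simp [divergence, comp_vf, dotProduct, Finset.sum_smul, smul_smul]

/-- `D(u, r)` has divergence zero if and only if `(u|r) = 0`. -/
lemma divergence_vf_eq_zero_iff {N : ℕ} (u : Fin (N + 1) → ℂ) (r : Fin (N + 1) → ℤ) :
    divergence N (vf u r) = 0 ↔ u ⬝ᵥ toC r = 0 := by
  rw [divergence_vf]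
  simp [mono]

lemma coeff_euler {N : ℕ} (j : Fin (N + 1)) (f : Laurent N) (r : Fin (N + 1) → ℤ) :
    (eulerLin j f).coeff r = (r j : ℂ) * f.coeff r := by
  have : (Finsupp.lapply r ∘ₗ (AddMonoidAlgebra.coeffLinearEquiv ℂ).toLinearMap) ∘ₗ eulerLin j =
      (r j : ℂ) • (Finsupp.lapply r ∘ₗ (AddMonoidAlgebra.coeffLinearEquiv ℂ :
        Laurent N ≃ₗ[ℂ] _).toLinearMap) := by
    refine laurent_hom_ext fun n => ?_
    by_cases h : n = r
    · subst h; simp only [LinearMap.comp_apply, eulerLin_mono]; simp [mono]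
    · simp only [LinearMap.comp_apply, eulerLin_mono]; simp [mono, h]
  exact congrArg (fun F => F f) this

lemma coeffVec_dot_eq_zero {N : ℕ} {X : Derivation ℂ (Laurent N) (Laurent N)}
    (hX : divergence N X = 0) (r : Fin (N + 1) → ℤ) : coeffVec r X ⬝ᵥ toC r = 0 := by
  have := congrArg (fun f : Laurent N => f.coeff r) hX
  simp only [divergence, LinearMap.sum_apply, LinearMap.comp_apply, AddMonoidAlgebra.coeff_sum,
    Finsupp.finsetSum_apply, coeff_euler, AddMonoidAlgebra.coeff_zero, Finsupp.zero_apply] at this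
  rw [← this]
  exact Finset.sum_congr rfl fun j _ => mul_comm _ _

/-- The Lie algebra `𝒟_div` of divergence-zero vector fields on the `(N+1)`-torus. -/
def DDiv (N : ℕ) : LieSubalgebra ℂ (Derivation ℂ (Laurent N) (Laurent N)) :=
  { LinearMap.ker (divergence N) with
    lie_mem' := by
      intro X Y hX hY
      change divergence N X = 0 at hX
      change divergence N Y = 0 at hY
      change divergence N ⁅X, Y⁆ = 0
      rw [eq_sum_vf X, eq_sum_vf Y]
      refine (congrArg (divergence N) (sum_lie_sum _ _ _ _)).trans ?_
      rw [map_sum]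
      refine Finset.sum_eq_zero fun r _ => ?_
      rw [map_sum]
      refine Finset.sum_eq_zero fun s _ => ?_
      rw [vf_bracket, divergence_vf_eq_zero_iff]
      have h1 := coeffVec_dot_eq_zero hX r
      have h2 := coeffVec_dot_eq_zero hY s
      simp only [toC_add, dotProduct_add, sub_dotProduct, smul_dotProduct, smul_eq_mul, h1, h2]
      ring }

lemma mem_DDiv {N : ℕ} {X : Derivation ℂ (Laurent N) (Laurent N)} :
    X ∈ DDiv N ↔ divergence N X = 0 := Iff.rfl

/-- The element `D(u, r)` of `𝒟_div`, for `(u|r) = 0`. -/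
def dvf {N : ℕ} (u : Fin (N + 1) → ℂ) (r : Fin (N + 1) → ℤ) (h : u ⬝ᵥ toC r = 0) : DDiv N :=
  ⟨vf u r, (divergence_vf_eq_zero_iff u r).2 h⟩

/-! ### The tensor modules -/

lemma DDiv_dot {N : ℕ} (X : DDiv N) (r : Fin (N + 1) → ℤ) : coeffVec r X.1 ⬝ᵥ toC r = 0 :=
  coeffVec_dot_eq_zero (mem_DDiv.1 X.2) r

/-- The Lie algebra `𝔰𝔩_{N+1}(ℂ)`. -/
abbrev SL (N : ℕ) : LieSubalgebra ℂ (Matrix (Fin (N + 1)) (Fin (N + 1)) ℂ) := sl (Fin (N + 1)) ℂ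

/-- The matrix `r uᵀ`, which is traceless because `(u|r) = 0`. -/
def rankOne {N : ℕ} (u : Fin (N + 1) → ℂ) (r : Fin (N + 1) → ℤ) (h : u ⬝ᵥ toC r = 0) : SL N :=
  ⟨Matrix.vecMulVec (toC r) u, by
    change Matrix.trace (Matrix.vecMulVec (toC r) u) = 0
    rw [Matrix.trace_vecMulVec, dotProduct_comm, h]⟩

lemma tensor_hom_ext {N : ℕ} {V M : Type*} [AddCommGroup V] [Module ℂ V] [AddCommGroup M]
    [Module ℂ M] {f g : V ⊗[ℂ] Laurent N →ₗ[ℂ] M}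
    (h : ∀ v n, f (v ⊗ₜ mono n) = g (v ⊗ₜ mono n)) : f = g :=
  TensorProduct.ext (LinearMap.ext fun v => laurent_hom_ext fun n => h v n)

/-- The operator `q^n ↦ (u|n + σ) q^{n+r}`. -/
def shiftOp {N : ℕ} (σ u : Fin (N + 1) → ℂ) (r : Fin (N + 1) → ℤ) : Laurent N →ₗ[ℂ] Laurent N :=
  LinearMap.mulLeft ℂ (mono r) ∘ₗ ∑ j, u j • (eulerLin j + σ j • LinearMap.id)

lemma shiftOp_mono {N : ℕ} (σ u : Fin (N + 1) → ℂ) (r n : Fin (N + 1) → ℤ) :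
    shiftOp σ u r (mono n) = (u ⬝ᵥ (toC n + σ)) • mono (n + r) := by
  simp [shiftOp, dotProduct, ← add_smul, smul_smul, ← Finset.sum_smul, add_comm r n, mul_add]

section
variable {N : ℕ} (σ : Fin (N + 1) → ℂ) (V : Type*) [AddCommGroup V] [Module ℂ V]
  [LieRingModule (SL N) V] [LieModule ℂ (SL N) V]

/-- The operator by which `D(u, r)`, `(u|r) = 0`, acts on `V ⊗ ℂ[q^{±1}]`:
`v ⊗ q^n ↦ (u|n + σ) v ⊗ q^{n+r} + (r uᵀ)v ⊗ q^{n+r}`. -/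
def homAct (u : Fin (N + 1) → ℂ) (r : Fin (N + 1) → ℤ) (h : u ⬝ᵥ toC r = 0) :
    V ⊗[ℂ] Laurent N →ₗ[ℂ] V ⊗[ℂ] Laurent N :=
  TensorProduct.map LinearMap.id (shiftOp σ u r) +
    TensorProduct.map (LieModule.toEnd ℂ (SL N) V (rankOne u r h)) (LinearMap.mulLeft ℂ (mono r))

lemma homAct_tmul_mono (u : Fin (N + 1) → ℂ) (r : Fin (N + 1) → ℤ) (h : u ⬝ᵥ toC r = 0)
    (v : V) (n : Fin (N + 1) → ℤ) :
    homAct σ V u r h (v ⊗ₜ mono n) =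
      (u ⬝ᵥ (toC n + σ)) • (v ⊗ₜ[ℂ] mono (n + r)) + ⁅rankOne u r h, v⁆ ⊗ₜ[ℂ] mono (n + r) := by
  simp [homAct, shiftOp_mono, add_comm r n]

lemma homAct_add {u v w : Fin (N + 1) → ℂ} {r : Fin (N + 1) → ℤ} (hu : u ⬝ᵥ toC r = 0)
    (hv : v ⬝ᵥ toC r = 0) (hw : w ⬝ᵥ toC r = 0) (e : w = u + v) :
    homAct σ V w r hw = homAct σ V u r hu + homAct σ V v r hv := by
  subst e
  have : rankOne (u + v) r hw = rankOne u r hu + rankOne v r hv :=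
    Subtype.ext (Matrix.vecMulVec_add _ _ _)
  refine tensor_hom_ext fun x n => ?_
  rw [LinearMap.add_apply, homAct_tmul_mono, homAct_tmul_mono, homAct_tmul_mono, this, add_lie,
    TensorProduct.add_tmul, add_dotProduct, add_smul]
  abel

lemma homAct_smul {u w : Fin (N + 1) → ℂ} {r : Fin (N + 1) → ℤ} (c : ℂ) (hu : u ⬝ᵥ toC r = 0)
    (hw : w ⬝ᵥ toC r = 0) (e : w = c • u) : homAct σ V w r hw = c • homAct σ V u r hu := by
  subst e
  have : rankOne (c • u) r hw = c • rankOne u r hu :=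
    Subtype.ext (Matrix.vecMulVec_smul _ _ _)
  refine tensor_hom_ext fun x n => ?_
  rw [LinearMap.smul_apply, homAct_tmul_mono, homAct_tmul_mono, this, smul_lie, smul_add,
    ← TensorProduct.smul_tmul', smul_dotProduct, smul_smul, smul_eq_mul]

lemma homAct_zero {u : Fin (N + 1) → ℂ} {r : Fin (N + 1) → ℤ} (hu : u ⬝ᵥ toC r = 0) (e : u = 0) :
    homAct σ V u r hu = 0 := by
  rw [homAct_smul σ V 0 hu hu (by simp [e]), zero_smul]

/-- The operator by which the degree `r` component of `X ∈ 𝒟_div` acts. -/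
def compAct (r : Fin (N + 1) → ℤ) : DDiv N →ₗ[ℂ] (V ⊗[ℂ] Laurent N →ₗ[ℂ] V ⊗[ℂ] Laurent N) where
  toFun X := homAct σ V (coeffVec r X.1) r (DDiv_dot X r)
  map_add' X Y := homAct_add σ V _ _ _ ((coeffVec r).map_add X.1 Y.1)
  map_smul' c X := homAct_smul σ V c _ _ ((coeffVec r).map_smul c X.1)

lemma compAct_eq_zero {X : DDiv N} {r : Fin (N + 1) → ℤ} (h : r ∉ degrees X.1) :
    compAct σ V r X = 0 := homAct_zero σ V _ (coeffVec_eq_zero h)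

lemma sum_compAct {X : DDiv N} {S : Finset (Fin (N + 1) → ℤ)} (h : degrees X.1 ⊆ S) :
    ∑ r ∈ degrees X.1, compAct σ V r X = ∑ r ∈ S, compAct σ V r X :=
  Finset.sum_subset h fun _ _ hr => compAct_eq_zero σ V hr

/-- The action of `𝒟_div` on `V ⊗ ℂ[q^{±1}]`: the linear extension of the action of the
homogeneous elements `D(u, r)`. -/
def act : DDiv N →ₗ[ℂ] (V ⊗[ℂ] Laurent N →ₗ[ℂ] V ⊗[ℂ] Laurent N) where
  toFun X := ∑ r ∈ degrees X.1, compAct σ V r X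
  map_add' X Y := by
    classical
    let S := degrees X.1 ∪ degrees Y.1 ∪ degrees (X + Y).1
    rw [sum_compAct σ V (S := S) (X := X) (fun a ha => by simp [S, ha]),
      sum_compAct σ V (S := S) (X := Y) (fun a ha => by simp [S, ha]),
      sum_compAct σ V (S := S) (X := X + Y) Finset.subset_union_right, ← Finset.sum_add_distrib]
    simp
  map_smul' c X := by
    classical
    let S := degrees X.1 ∪ degrees (c • X).1
    rw [sum_compAct σ V (S := S) (X := X) Finset.subset_union_left,
      sum_compAct σ V (S := S) (X := c • X) Finset.subset_union_right]
    simp [Finset.smul_sum]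

lemma act_dvf (u : Fin (N + 1) → ℂ) (r : Fin (N + 1) → ℤ) (h : u ⬝ᵥ toC r = 0) :
    act σ V (dvf u r h) = homAct σ V u r h := by
  classical
  change ∑ s ∈ degrees (dvf u r h).1, compAct σ V s (dvf u r h) = _
  rw [sum_compAct σ V (S := insert r (degrees (dvf u r h).1)) (Finset.subset_insert _ _),
    Finset.sum_eq_single_of_mem r (Finset.mem_insert_self _ _)]
  · change homAct σ V (coeffVec r (vf u r)) r _ = _
    congr 1
    exact coeffVec_vf_self u r
  · intro s _ hs
    exact homAct_zero σ V _ (coeffVec_vf_of_ne u hs)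

lemma bracket_dot {u v : Fin (N + 1) → ℂ} {r s : Fin (N + 1) → ℤ}
    (hu : u ⬝ᵥ toC r = 0) (hv : v ⬝ᵥ toC s = 0) :
    ((u ⬝ᵥ toC s) • v - (v ⬝ᵥ toC r) • u) ⬝ᵥ toC (r + s) = 0 := by
  simp only [toC_add, dotProduct_add, sub_dotProduct, smul_dotProduct, smul_eq_mul, hu, hv]
  ring

lemma rankOne_bracket {u v : Fin (N + 1) → ℂ} {r s : Fin (N + 1) → ℤ}
    (hu : u ⬝ᵥ toC r = 0) (hv : v ⬝ᵥ toC s = 0) :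
    rankOne ((u ⬝ᵥ toC s) • v - (v ⬝ᵥ toC r) • u) (r + s) (bracket_dot hu hv) =
      ⁅rankOne u r hu, rankOne v s hv⁆ + (u ⬝ᵥ toC s) • rankOne v s hv
        - (v ⬝ᵥ toC r) • rankOne u r hu := by
  apply Subtype.ext
  change Matrix.vecMulVec (toC (r + s)) ((u ⬝ᵥ toC s) • v - (v ⬝ᵥ toC r) • u) =
    Matrix.vecMulVec (toC r) u * Matrix.vecMulVec (toC s) v -
      Matrix.vecMulVec (toC s) v * Matrix.vecMulVec (toC r) u +
      (u ⬝ᵥ toC s) • Matrix.vecMulVec (toC s) v - (v ⬝ᵥ toC r) • Matrix.vecMulVec (toC r) u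
  rw [Matrix.vecMulVec_mul_vecMulVec, Matrix.vecMulVec_mul_vecMulVec]
  ext i j
  simp [Matrix.vecMulVec_apply]
  ring

lemma homAct_bracket {u v : Fin (N + 1) → ℂ} {r s : Fin (N + 1) → ℤ}
    (hu : u ⬝ᵥ toC r = 0) (hv : v ⬝ᵥ toC s = 0) :
    homAct σ V ((u ⬝ᵥ toC s) • v - (v ⬝ᵥ toC r) • u) (r + s) (bracket_dot hu hv) =
      homAct σ V u r hu ∘ₗ homAct σ V v s hv - homAct σ V v s hv ∘ₗ homAct σ V u r hu := by
  refine tensor_hom_ext fun w n => ?_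
  simp only [LinearMap.sub_apply,
    LinearMap.comp_apply, homAct_tmul_mono, map_add, map_smul, rankOne_bracket hu hv, sub_lie,
    add_lie, smul_lie, lie_lie, TensorProduct.add_tmul, TensorProduct.sub_tmul]
  rw [show n + s + r = n + (r + s) by abel, show n + r + s = n + (r + s) by abel]
  simp only [toC_add, dotProduct_add, sub_dotProduct, smul_dotProduct, smul_eq_mul,
    ← TensorProduct.smul_tmul']
  module

lemma dvf_bracket {u v : Fin (N + 1) → ℂ} {r s : Fin (N + 1) → ℤ}
    (hu : u ⬝ᵥ toC r = 0) (hv : v ⬝ᵥ toC s = 0) :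
    ⁅dvf u r hu, dvf v s hv⁆ =
      dvf ((u ⬝ᵥ toC s) • v - (v ⬝ᵥ toC r) • u) (r + s) (bracket_dot hu hv) :=
  Subtype.ext (vf_bracket u v r s)

lemma eq_sum_dvf (X : DDiv N) :
    X = ∑ r ∈ degrees X.1, dvf (coeffVec r X.1) r (DDiv_dot X r) := by
  apply Subtype.ext
  rw [AddSubmonoidClass.coe_finsetSum]
  exact eq_sum_vf X.1

lemma act_bracket (X Y : DDiv N) :
    act σ V ⁅X, Y⁆ = act σ V X ∘ₗ act σ V Y - act σ V Y ∘ₗ act σ V X := by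
  have key : ∀ r s, act σ V ⁅dvf (coeffVec r X.1) r (DDiv_dot X r),
        dvf (coeffVec s Y.1) s (DDiv_dot Y s)⁆ =
      act σ V (dvf (coeffVec r X.1) r (DDiv_dot X r)) ∘ₗ
          act σ V (dvf (coeffVec s Y.1) s (DDiv_dot Y s)) -
        act σ V (dvf (coeffVec s Y.1) s (DDiv_dot Y s)) ∘ₗ
          act σ V (dvf (coeffVec r X.1) r (DDiv_dot X r)) := by
    intro r s
    rw [dvf_bracket, act_dvf, act_dvf, act_dvf, homAct_bracket]
  generalize hx : (fun r => dvf (coeffVec r X.1) r (DDiv_dot X r)) = x at *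
  generalize hy : (fun s => dvf (coeffVec s Y.1) s (DDiv_dot Y s)) = y at *
  have key' : ∀ r s, act σ V ⁅x r, y s⁆ =
      act σ V (x r) ∘ₗ act σ V (y s) - act σ V (y s) ∘ₗ act σ V (x r) := by
    subst hx hy; exact key
  clear key
  have hX : X = ∑ r ∈ degrees X.1, x r := by subst hx; exact eq_sum_dvf X
  have hY : Y = ∑ r ∈ degrees Y.1, y r := by subst hy; exact eq_sum_dvf Y
  rw [hX, hY]
  generalize degrees X.1 = S
  generalize degrees Y.1 = T
  change _ = (act σ V (∑ r ∈ S, x r) : Module.End ℂ (V ⊗[ℂ] Laurent N)) *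
      act σ V (∑ r ∈ T, y r) -
    (act σ V (∑ r ∈ T, y r) : Module.End ℂ (V ⊗[ℂ] Laurent N)) * act σ V (∑ r ∈ S, x r)
  rw [map_sum, map_sum, Finset.sum_mul_sum, Finset.sum_mul_sum, Finset.sum_comm (s := T),
    sum_lie_sum, map_sum]
  simp only [map_sum, key', Finset.sum_sub_distrib]
  rfl

end

/-- The tensor module `F^σ(V) = V ⊗ ℂ[q₁^{±1}, …, q_{N+1}^{±1}]`. -/
def TensorModule {N : ℕ} (_σ : Fin (N + 1) → ℂ) (V : Type*) [AddCommGroup V] [Module ℂ V] :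
    Type _ := V ⊗[ℂ] Laurent N

section
variable {N : ℕ} (σ : Fin (N + 1) → ℂ) (V : Type*) [AddCommGroup V] [Module ℂ V]

instance : AddCommGroup (TensorModule σ V) := inferInstanceAs (AddCommGroup (V ⊗[ℂ] Laurent N))

instance : Module ℂ (TensorModule σ V) := inferInstanceAs (Module ℂ (V ⊗[ℂ] Laurent N))

variable [LieRingModule (SL N) V] [LieModule ℂ (SL N) V]

instance : LieRingModule (DDiv N) (TensorModule σ V) where
  bracket X w := act σ V X w
  add_lie X Y w := congrArg (fun F => F w) ((act σ V).map_add X Y)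
  lie_add X := (act σ V X).map_add
  leibniz_lie X Y w := by
    change act σ V X (act σ V Y w) = act σ V ⁅X, Y⁆ w + act σ V Y (act σ V X w)
    rw [act_bracket]
    exact (sub_add_cancel _ _).symm

instance : LieModule ℂ (DDiv N) (TensorModule σ V) where
  smul_lie c X w := congrArg (fun F => F w) ((act σ V).map_smul c X)
  lie_smul c X := (act σ V X).map_smul c

/-- The homogeneous element `v(n) = v ⊗ q^n` of `F^σ(V)`. -/
def TensorModule.elt {V : Type*} [AddCommGroup V] [Module ℂ V] (v : V) (n : Fin (N + 1) → ℤ) :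
    TensorModule σ V := v ⊗ₜ[ℂ] (mono n : Laurent N)

/-- The defining formula of the action:
`D(u, r) . v(n) = (u|n + σ) v(n + r) + ((r uᵀ) v)(n + r)`. -/
lemma dvf_lie_elt (u : Fin (N + 1) → ℂ) (r : Fin (N + 1) → ℤ) (h : u ⬝ᵥ toC r = 0)
    (v : V) (n : Fin (N + 1) → ℤ) :
    ⁅dvf u r h, TensorModule.elt σ v n⁆ =
      (u ⬝ᵥ (toC n + σ)) • TensorModule.elt σ v (n + r) +
        TensorModule.elt σ ⁅rankOne u r h, v⁆ (n + r) := by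
  change act σ V (dvf u r h) (v ⊗ₜ mono n) = _
  rw [act_dvf, homAct_tmul_mono]
  rfl

end

/-! ### Highest weights -/

/-- A dominant weight `λ = C₁ω₁ + ⋯ + C_Nω_N` of `𝔰𝔩_{N+1}`, given by its label `(C₁, …, C_N)`,
that is, `C_k = ⟨λ, α_k⟩`. The index `k : Fin N` stands for the simple root `α_{k+1}`. -/
abbrev DominantWeight (N : ℕ) : Type := Fin N → ℕ

/-- The fundamental weight `ω_{k+1}`. -/
def fundamentalWeight {N : ℕ} (k : Fin N) : DominantWeight N := Pi.single k 1

/-- `v` is a highest weight vector of weight `C`: a nonzero vector killed by all `E_{ij}` with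
`i < j`, on which the coroot `E_{kk} - E_{k+1,k+1}` acts as the scalar `C_k`. -/
def IsHighestWeightVector {N : ℕ} {V : Type*} [AddCommGroup V] [Module ℂ V]
    [LieRingModule (SL N) V] (C : DominantWeight N) (v : V) : Prop :=
  v ≠ 0 ∧
    (∀ (i j : Fin (N + 1)) (h : i < j), ⁅(single i j h.ne (1 : ℂ) : SL N), v⁆ = 0) ∧
    ∀ k : Fin N, ⁅(singleSubSingle k.castSucc k.succ (1 : ℂ) : SL N), v⁆ = (C k : ℂ) • v

/-- `V` is a copy of `V(λ)`: a finite dimensional irreducible `𝔰𝔩_{N+1}`-module of highest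
weight `λ = C`. -/
structure IsIrreducibleOfHighestWeight {N : ℕ} (C : DominantWeight N) (V : Type*)
    [AddCommGroup V] [Module ℂ V] [LieRingModule (SL N) V] [LieModule ℂ (SL N) V] : Prop where
  finiteDimensional : FiniteDimensional ℂ V
  irreducible : LieModule.IsIrreducible ℂ (SL N) V
  exists_highestWeightVector : ∃ v : V, IsHighestWeightVector C v

end TorusFields

end

/-! The operators `D(u, 0)` act diagonally on degrees and separate them, so a submodule `M` is the
sum of its components `component M n ⊆ V`. The idea is to find enough operators preserving a single
component. If `(u|r) = 0`, then `D(u, -r) D(u, r)` returns degree `n` to itself and acts there as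
`α² - P²`, where `P` is the action of `r uᵀ` and `α = (u|n + σ)`. Hence every component is stable
under the algebra generated by the squares `P²`, which depends on neither `n` nor `σ`
(`squareAlgebra_component`).

This algebra `A` acts irreducibly on `V`. Conjugation by `1 + t E_{kl}` permutes the generators, so
taking the linear term in `t` shows that `A` is stable under commutators with `𝔰𝔩`
(`squareAlgebra_adStable`). It contains `e²` for each root vector `e = E_{ij}`, and an identity in
`U(𝔰𝔩₂)` puts `f e²` in `A` as well (`mul_sq_mem_of_sl2`). Root vectors commuting with `e` then
carry `f` to all of `𝔰𝔩`, so `Y e² ∈ A` for every `Y` (`mul_single_sq_mem`). If `e² ≠ 0`, a minimal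
nonzero `A`-stable subspace must be an `𝔰𝔩`-submodule, hence all of `V` (`eq_top_of_adStable`).

The weight enters only in `single_sq_ne_zero`: the square of the lowest root vector is nonzero
because `C₁ + ⋯ + C_N ≥ 2`, which excludes exactly `0` and the `ω_k`. So each component of `M` is
`0` or `V`. A full component has no zero neighbour, since otherwise some `E_{ij}` would act as a
scalar (`component_add_single_ne_bot`); thus one nonzero component forces all of them to be full. -/

noncomputable section

namespace TorusFields

open LieAlgebra.SpecialLinear

attribute [local instance 100] LieRing.ofAssociativeRing

/-! ### Operator algebras stable under commutators with a Lie algebra -/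

section General

set_option linter.unusedSimpArgs false in
/-- In a representation of `𝔰𝔩₂`, an algebra of operators that contains `e²` and is closed under the
commutators with `f` contains `f e²`. -/
lemma mul_sq_mem_of_sl2 {B : Type*} [Ring B] [Algebra ℂ B] (A : Subalgebra ℂ B) {e f h : B}
    (hef : e * f = f * e + h) (heh : e * h = h * e - 2 * e) (hhf : h * f = f * h - 2 * f)
    (hf : ∀ a ∈ A, f * a - a * f ∈ A) (he2 : e * e ∈ A) : f * (e * e) ∈ A := by
  have hef' (x : B) : e * (f * x) = f * (e * x) + h * x := by
    rw [← mul_assoc, hef, add_mul, mul_assoc]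
  have heh' (x : B) : e * (h * x) = h * (e * x) - 2 * (e * x) := by
    rw [← mul_assoc, heh, sub_mul, mul_assoc, mul_assoc]
  have hhf' (x : B) : h * (f * x) = f * (h * x) - 2 * (f * x) := by
    rw [← mul_assoc, hhf, sub_mul, mul_assoc, mul_assoc]
  -- Up to scalars, `h2`, `h0` and `hm2` are the successive images of `e²` under `ad f`.
  have h2 : h * e + e * h ∈ A := by
    have := A.neg_mem (hf _ he2)
    convert this using 1
    simp only [hef, heh, hhf, hef', heh', hhf', mul_add, add_mul, mul_sub, sub_mul, mul_assoc,
      two_mul]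
    abel
  have h0 : e * f + f * e - h * h ∈ A := by
    have := A.smul_mem (hf _ h2) (1 / 2 : ℂ)
    convert this using 1
    simp only [hef, heh, hhf, hef', heh', hhf', mul_add, add_mul, mul_sub, sub_mul, mul_assoc,
      two_mul]
    module
  have hm2 : h * f + f * h ∈ A := by
    have := A.smul_mem (hf _ h0) (-1 / 3 : ℂ)
    convert this using 1
    simp only [hef, heh, hhf, hef', heh', hhf', mul_add, add_mul, mul_sub, sub_mul, mul_assoc,
      two_mul]
    module
  -- Both commutators are cubic of weight 2. To leading order they are `-8 f e² + 4 h² e` and `12 h²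
  -- e`, so `h3 / 24 - h1 / 8` isolates `f e²`; the remaining lower-order term is a multiple of
  -- `h2`.
  have h1 := A.sub_mem (A.mul_mem he2 hm2) (A.mul_mem hm2 he2)
  have h3 := A.sub_mem (A.mul_mem h2 h0) (A.mul_mem h0 h2)
  have := A.sub_mem (A.sub_mem (A.smul_mem h3 (1 / 24 : ℂ)) (A.smul_mem h1 (1 / 8 : ℂ)))
    (A.smul_mem h2 (1 / 2 : ℂ))
  convert this using 1
  simp only [hef, heh, hhf, hef', heh', hhf', mul_add, add_mul, mul_sub, sub_mul, mul_assoc,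
    two_mul]
  module

variable {L V : Type*} [LieRing L] [LieAlgebra ℂ L] [AddCommGroup V] [Module ℂ V]
  [LieRingModule L V] [LieModule ℂ L V]

lemma toEnd_lie (X Y : L) : LieModule.toEnd ℂ L V ⁅X, Y⁆ =
    LieModule.toEnd ℂ L V X * LieModule.toEnd ℂ L V Y -
      LieModule.toEnd ℂ L V Y * LieModule.toEnd ℂ L V X := by
  ext v; simp

/-- Let `A` be an algebra of operators on an irreducible module that is closed under commutators
with the Lie algebra, and suppose that it contains `t` and all `Y t` for some `t ≠ 0`. Then `A` acts
irreducibly. -/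
lemma eq_top_of_adStable [FiniteDimensional ℂ V] [LieModule.IsIrreducible ℂ L V]
    (A : Subalgebra ℂ (Module.End ℂ V))
    (hA : ∀ (Y : L), ∀ a ∈ A, LieModule.toEnd ℂ L V Y * a - a * LieModule.toEnd ℂ L V Y ∈ A)
    {t : Module.End ℂ V} (ht0 : t ≠ 0) (ht : t ∈ A)
    (htY : ∀ Y : L, LieModule.toEnd ℂ L V Y * t ∈ A)
    {M : Submodule ℂ V} (hM : ∀ a ∈ A, ∀ m ∈ M, a m ∈ M) (hM0 : M ≠ ⊥) : M = ⊤ := by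
  let S : Set (Module.End ℂ V) := {s | s ∈ A ∧ ∀ Y : L, LieModule.toEnd ℂ L V Y * s ∈ A}
  have hS (Z : L) (s) (hs : s ∈ S) :
      LieModule.toEnd ℂ L V Z * s - s * LieModule.toEnd ℂ L V Z ∈ S := by
    -- `Y [Z, s] = [Z, Y s] - [Z, Y] s`, and both terms lie in `A`.
    refine ⟨hA _ _ hs.1, fun Y => ?_⟩
    have := A.sub_mem (hA Z _ (hs.2 Y)) (hs.2 ⁅Z, Y⁆)
    convert this using 1
    rw [toEnd_lie]
    noncomm_ring
  -- The common kernel of `S` is a submodule because `S` is stable under commutators; `t ∈ S` is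
  -- nonzero, so the kernel is zero.
  let W : LieSubmodule ℂ L V :=
    { carrier := {v | ∀ s ∈ S, s v = 0}
      add_mem' := fun {v w} hv hw s hs => by rw [map_add, hv s hs, hw s hs, add_zero]
      zero_mem' := fun s _ => map_zero s
      smul_mem' := fun c v hv s hs => by rw [map_smul, hv s hs, smul_zero]
      lie_mem := by
        intro Z v hv s hs
        have h1 := hv _ (hS Z s hs)
        simpa [hv s hs] using h1 }
  have hW : W = ⊥ := by
    by_contra h
    have hT := (eq_bot_or_eq_top W).resolve_left h
    refine ht0 (LinearMap.ext fun v => ?_)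
    have : v ∈ W := hT ▸ LieSubmodule.mem_top v
    exact this t ⟨ht, htY⟩
  let P : Submodule ℂ V → Prop := fun M' => M' ≠ ⊥ ∧ M' ≤ M ∧ ∀ a ∈ A, ∀ m ∈ M', a m ∈ M'
  obtain ⟨M', ⟨h0, hle, hst⟩, hmin⟩ := exists_minimal_of_wellFoundedLT P ⟨M, hM0, le_rfl, hM⟩
  -- The part of `M'` that the Lie algebra keeps in `M'`. It contains `s m` for `s ∈ S` and `m ∈
  -- M'`, hence is nonzero, and minimality makes it equal to `M'`.
  let M'' : Submodule ℂ V :=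
    { carrier := {m | m ∈ M' ∧ ∀ Y : L, ⁅Y, m⁆ ∈ M'}
      add_mem' := fun {v w} hv hw => ⟨M'.add_mem hv.1 hw.1, fun Y => by
        rw [lie_add]; exact M'.add_mem (hv.2 Y) (hw.2 Y)⟩
      zero_mem' := ⟨M'.zero_mem, fun Y => by rw [lie_zero]; exact M'.zero_mem⟩
      smul_mem' := fun c v hv => ⟨M'.smul_mem c hv.1, fun Y => by
        rw [lie_smul]; exact M'.smul_mem c (hv.2 Y)⟩ }
  have hle' : M'' ≤ M' := fun m hm => hm.1
  have hP : P M'' := by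
    refine ⟨?_, hle'.trans hle, fun a ha m hm => ⟨hst a ha m hm.1, fun Y => ?_⟩⟩
    · obtain ⟨m, hm, hm0⟩ := M'.ne_bot_iff.1 h0
      have : m ∉ W := by rwa [hW, LieSubmodule.mem_bot]
      have : ∃ s ∈ S, s m ≠ 0 := by
        by_contra! h
        exact this h
      obtain ⟨s, hs, hsm⟩ := this
      exact (Submodule.ne_bot_iff _).2 ⟨s m, ⟨hst s hs.1 m hm, fun Y => hst _ (hs.2 Y) m hm⟩, hsm⟩
    · have h1 := hst _ (hA Y a ha) m hm.1
      have h2 := hst a ha _ (hm.2 Y)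
      have := M'.add_mem h1 h2
      simpa using this
  have hge : M' ≤ M'' := hmin hP hle'
  let K : LieSubmodule ℂ L V := { M' with lie_mem := fun {Y m} hm => (hge hm).2 Y }
  have hK : K = ⊤ := (eq_bot_or_eq_top K).resolve_left fun h => h0 <| by
    have := congrArg LieSubmodule.toSubmodule h
    simpa [K] using this
  have : M' = ⊤ := by
    have := congrArg LieSubmodule.toSubmodule hK
    simpa [K] using this
  exact top_le_iff.1 (this ▸ hle)

end General

/-! ### Matrix units and generation of `𝔰𝔩` -/

section SpecialLinear

variable {N : ℕ}

/-- The matrices `E_{kl}`, `k ≠ l`, and `E_{kk} - E_{jj}` span `𝔰𝔩`. -/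
lemma sl_submodule_eq_top {D : Submodule ℂ (SL N)} (j : Fin (N + 1))
    (hE : ∀ (k l : Fin (N + 1)) (h : k ≠ l), single k l h (1 : ℂ) ∈ D)
    (hH : ∀ k : Fin (N + 1), k ≠ j → singleSubSingle k j (1 : ℂ) ∈ D) : D = ⊤ := by
  let D' : Submodule ℂ (Matrix (Fin (N + 1)) (Fin (N + 1)) ℂ) := D.map (SL N).toSubmodule.subtype
  have key (x : Matrix (Fin (N + 1)) (Fin (N + 1)) ℂ) :
      x - x.trace • Matrix.single j j 1 ∈ D' := by
    induction x using Matrix.induction_on with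
    | h_add x y hx hy =>
      have := D'.add_mem hx hy
      convert this using 1
      rw [Matrix.trace_add, add_smul]
      abel
    | h_std_basis k l c =>
      have hc : (Matrix.single k l c : Matrix (Fin (N + 1)) (Fin (N + 1)) ℂ) =
          c • Matrix.single k l 1 := by simp
      rw [hc, Matrix.trace_smul, smul_assoc, ← smul_sub]
      refine D'.smul_mem _ ?_
      rcases eq_or_ne k l with rfl | h
      · rcases eq_or_ne k j with rfl | hk
        · simp
        · exact ⟨_, hH k hk, by simp⟩
      · exact ⟨_, hE k l h, by simp [Matrix.trace_single_eq_of_ne _ _ _ h]⟩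
  refine Submodule.eq_top_iff'.2 fun x => ?_
  have h0 : x.1.trace = 0 := x.2
  obtain ⟨y, hy, hyx⟩ := key x.1
  rw [h0, zero_smul, sub_zero] at hyx
  exact (Subtype.ext hyx : y = x) ▸ hy

lemma single_lie_single {k l m : Fin (N + 1)} (hkl : k ≠ l) (hlm : l ≠ m) (hkm : k ≠ m) :
    ⁅(single k l hkl (1 : ℂ) : SL N), (single l m hlm (1 : ℂ) : SL N)⁆ = single k m hkm 1 := by
  apply Subtype.ext
  rw [sl_bracket]
  simp [hkm.symm]

lemma single_lie_single_swap {k l : Fin (N + 1)} (h : k ≠ l) :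
    ⁅(single k l h (1 : ℂ) : SL N), (single l k h.symm (1 : ℂ) : SL N)⁆ =
      singleSubSingle k l 1 := by
  apply Subtype.ext
  rw [sl_bracket]
  simp

lemma single_lie_single_of_ne {k l m n : Fin (N + 1)} (hkl : k ≠ l) (hmn : m ≠ n) (hlm : l ≠ m)
    (hkn : k ≠ n) :
    ⁅(single k l hkl (1 : ℂ) : SL N), (single m n hmn (1 : ℂ) : SL N)⁆ = 0 := by
  apply Subtype.ext
  rw [sl_bracket]
  simp [hlm, hkn.symm]

lemma singleSubSingle_lie_single {k l : Fin (N + 1)} (h : k ≠ l) :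
    ⁅(singleSubSingle k l (1 : ℂ) : SL N), (single k l h (1 : ℂ) : SL N)⁆ =
      (2 : ℂ) • single k l h 1 := by
  apply Subtype.ext
  rw [sl_bracket]
  simp [h.symm, sub_mul, mul_sub, two_smul]

/-- A subspace of `𝔰𝔩` that contains `E_{ji}` and is stable under the normalizer of the line through
`E_{ij}` is everything. -/
lemma eq_top_of_normalizer_stable {D : Submodule ℂ (SL N)} {i j : Fin (N + 1)} (hij : i ≠ j)
    (hji : single j i hij.symm (1 : ℂ) ∈ D)
    (hD : ∀ Z Y : SL N, Y ∈ D → (∃ c : ℂ, ⁅Z, single i j hij (1 : ℂ)⁆ = c • single i j hij (1 : ℂ)) →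
      ⁅Z, Y⁆ ∈ D) : D = ⊤ := by
  -- The root vectors commuting with `E_{ij}` suffice. If `E_{ij}` is taken as highest root vector,
  -- they include all positive ones, and these generate the adjoint module from its lowest vector
  -- `E_{ji}`.
  have hZ {k l : Fin (N + 1)} (hkl : k ≠ l) (hli : l ≠ i) (hkj : k ≠ j) (Y : SL N) (hY : Y ∈ D) :
      ⁅(single k l hkl (1 : ℂ) : SL N), Y⁆ ∈ D :=
    hD _ _ hY ⟨0, by rw [single_lie_single_of_ne _ _ hli hkj, zero_smul]⟩
  have hH : singleSubSingle i j (1 : ℂ) ∈ D := by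
    rw [← single_lie_single_swap hij]
    exact hZ hij hij.symm hij _ hji
  have hE : single i j hij (1 : ℂ) ∈ D := by
    have := hZ hij hij.symm hij _ hH
    rw [← lie_skew, singleSubSingle_lie_single] at this
    exact (D.smul_mem_iff two_ne_zero).1 (D.neg_mem_iff.1 this)
  have hjl {l : Fin (N + 1)} (hl : j ≠ l) : single j l hl (1 : ℂ) ∈ D := by
    rcases eq_or_ne l i with rfl | hli
    · exact hji
    · have := hZ hli.symm hli hij _ hji
      rw [← lie_skew, single_lie_single hij.symm hli.symm hl] at this
      exact D.neg_mem_iff.1 this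
  have hall {k l : Fin (N + 1)} (hkl : k ≠ l) : single k l hkl (1 : ℂ) ∈ D := by
    rcases eq_or_ne k j with rfl | hkj
    · exact hjl hkl
    · rcases eq_or_ne l j with rfl | hlj
      · rcases eq_or_ne k i with rfl | hki
        · exact hE
        · have h1 := hZ hkj hij.symm hkj _ hji
          rw [single_lie_single hkj hij.symm hki] at h1
          have h2 := hZ hij hij.symm hij _ h1
          rw [← lie_skew, single_lie_single hki hij hkj] at h2
          exact D.neg_mem_iff.1 h2
      · rw [← single_lie_single hkj hlj.symm hkl]
        exact hZ hkj hij.symm hkj _ (hjl _)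
  refine sl_submodule_eq_top j (fun k l h => hall h) fun k hk => ?_
  rw [← single_lie_single_swap hk]
  exact hZ hk hij.symm hk _ (hall _)

end SpecialLinear

/-! ### The algebra generated by the squares of rank-one operators -/

section SquareAlgebra

variable {N : ℕ} (V : Type*) [AddCommGroup V] [Module ℂ V]
  [LieRingModule (SL N) V] [LieModule ℂ (SL N) V]

/-- The squares of the operators by which the matrices `r uᵀ`, with integral orthogonal `u` and `r`,
act on `V`. -/
def squares : Set (Module.End ℂ V) :=
  {a | ∃ (u r : Fin (N + 1) → ℤ) (h : toC u ⬝ᵥ toC r = 0),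
    a = LieModule.toEnd ℂ (SL N) V (rankOne (toC u) r h) *
      LieModule.toEnd ℂ (SL N) V (rankOne (toC u) r h)}

/-- The algebra generated by the squares of the operators `r uᵀ`. -/
def squareAlgebra : Subalgebra ℂ (Module.End ℂ V) := Algebra.adjoin ℂ (squares (N := N) V)

variable {V}

lemma rankOne_val (u : Fin (N + 1) → ℂ) (r : Fin (N + 1) → ℤ) (h : u ⬝ᵥ toC r = 0) :
    (rankOne u r h).val = Matrix.vecMulVec (toC r) u := rfl

/-- The conjugate of `r uᵀ` by `1 + t E_{kl}`. -/
lemma exists_rankOne_conj {u r : Fin (N + 1) → ℤ} (h : toC u ⬝ᵥ toC r = 0) {k l : Fin (N + 1)}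
    (hkl : k ≠ l) (t : ℤ) :
    ∃ (u' r' : Fin (N + 1) → ℤ) (h' : toC u' ⬝ᵥ toC r' = 0),
      rankOne (toC u') r' h' = rankOne (toC u) r h +
        (t : ℂ) • ⁅(single k l hkl (1 : ℂ) : SL N), rankOne (toC u) r h⁆ -
          ((t : ℂ) ^ 2 * (r l * u k)) • single k l hkl 1 := by
  have e1 : toC (u - Pi.single l (t * u k)) = toC u - Pi.single l ((t : ℂ) * u k) := by
    ext a
    rcases eq_or_ne a l with rfl | ha <;> simp [*]
  have e2 : toC (r + Pi.single k (t * r l)) = toC r + Pi.single k ((t : ℂ) * r l) := by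
    ext a
    rcases eq_or_ne a k with rfl | ha <;> simp [*]
  refine ⟨u - Pi.single l (t * u k), r + Pi.single k (t * r l), ?_, ?_⟩
  · rw [e1, e2]
    simp [h, hkl]
    ring
  · apply Subtype.ext
    simp only [AddSubgroupClass.coe_sub, AddMemClass.coe_add, SetLike.val_smul, sl_bracket,
      val_single, rankOne_val]
    rw [e1, e2]
    ext a b
    have hs (x : ℂ) : Matrix.single k l x a b = if a = k ∧ b = l then x else 0 := by
      simp only [Matrix.single_apply, eq_comm]
    rcases eq_or_ne a k with rfl | ha <;> rcases eq_or_ne b l with rfl | hb <;>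
      simp [*, Matrix.vecMulVec_apply] <;> ring

/-- Conjugating by `1 + t E_{kl}` with `t` an integer keeps `u` and `r` integral, so the conjugated
squares are again generators. They are polynomial in `t`, and their linear coefficient is the
commutator. -/
lemma squares_commutator_mem {a : Module.End ℂ V} (ha : a ∈ squares (N := N) V) {k l : Fin (N + 1)}
    (hkl : k ≠ l) :
    LieModule.toEnd ℂ (SL N) V (single k l hkl 1) * a -
      a * LieModule.toEnd ℂ (SL N) V (single k l hkl 1) ∈ squareAlgebra (N := N) V := by
  obtain ⟨u, r, h, rfl⟩ := ha
  set E := LieModule.toEnd ℂ (SL N) V (single k l hkl 1) with hE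
  set P := LieModule.toEnd ℂ (SL N) V (rankOne (toC u) r h) with hP
  have key (t : ℤ) : (P + (t : ℂ) • (E * P - P * E) - ((t : ℂ) ^ 2 * (r l * u k)) • E) *
      (P + (t : ℂ) • (E * P - P * E) - ((t : ℂ) ^ 2 * (r l * u k)) • E) ∈
        squareAlgebra (N := N) V := by
    obtain ⟨u', r', h', he⟩ := exists_rankOne_conj h hkl t
    have := Algebra.subset_adjoin (R := ℂ) (s := squares (N := N) V) ⟨u', r', h', rfl⟩
    rw [he, map_sub, map_add, map_smul, map_smul, toEnd_lie] at this
    exact this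
  generalize (r l * u k : ℂ) = c at key
  -- Differences at `±t` leave `2 (a₁ t + a₃ t³)`. The weights `2/3` and `1/12` cancel `a₃` and give
  -- `a₁` coefficient 1.
  have A1 := (squareAlgebra (N := N) V).sub_mem (key 1) (key (-1))
  have A2 := (squareAlgebra (N := N) V).sub_mem (key 2) (key (-2))
  have A3 := (squareAlgebra (N := N) V).sub_mem
    ((squareAlgebra (N := N) V).smul_mem A1 (2 / 3 : ℂ))
    ((squareAlgebra (N := N) V).smul_mem A2 (1 / 12 : ℂ))
  have e : E * (P * P) - P * P * E = P * (E * P - P * E) + (E * P - P * E) * P := by noncomm_ring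
  rw [e]
  generalize E * P - P * E = Q at *
  convert A3 using 1
  simp only [mul_add, add_mul, mul_sub, sub_mul, smul_mul_assoc, mul_smul_comm, Int.cast_neg,
    Int.cast_one, Int.cast_ofNat]
  module

/-- A commutator is a derivation, so generators suffice for each `E_{kl}`; the Jacobi identity then
covers the diagonal elements `[E_{kj}, E_{jk}]`. -/
lemma squareAlgebra_adStable (Y : SL N) {a : Module.End ℂ V} (ha : a ∈ squareAlgebra (N := N) V) :
    LieModule.toEnd ℂ (SL N) V Y * a - a * LieModule.toEnd ℂ (SL N) V Y ∈
      squareAlgebra (N := N) V := by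
  have h1 {k l : Fin (N + 1)} (hkl : k ≠ l) {a : Module.End ℂ V}
      (ha : a ∈ squareAlgebra (N := N) V) :
      LieModule.toEnd ℂ (SL N) V (single k l hkl 1) * a -
        a * LieModule.toEnd ℂ (SL N) V (single k l hkl 1) ∈ squareAlgebra (N := N) V := by
    induction ha using Algebra.adjoin_induction with
    | mem x hx => exact squares_commutator_mem hx hkl
    | algebraMap c => rw [Algebra.commutes, sub_self]; exact zero_mem _
    | add x y hx hy ihx ihy =>
      have := add_mem ihx ihy
      convert this using 1
      noncomm_ring
    | mul x y hx hy ihx ihy =>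
      have := add_mem (mul_mem ihx hy) (mul_mem hx ihy)
      convert this using 1
      noncomm_ring
  let D : Submodule ℂ (SL N) :=
    { carrier := {Y | ∀ a ∈ squareAlgebra (N := N) V, LieModule.toEnd ℂ (SL N) V Y * a -
        a * LieModule.toEnd ℂ (SL N) V Y ∈ squareAlgebra (N := N) V}
      add_mem' := fun {X Y} hX hY a ha => by
        have := add_mem (hX a ha) (hY a ha)
        convert this using 1
        rw [map_add]
        noncomm_ring
      zero_mem' := fun a _ => by simp
      smul_mem' := fun c X hX a ha => by
        have := (squareAlgebra (N := N) V).smul_mem (hX a ha) c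
        rwa [smul_sub, ← smul_mul_assoc, ← mul_smul_comm, ← map_smul] at this }
  have hD : D = ⊤ := by
    refine sl_submodule_eq_top 0 (fun k l h a ha => h1 h ha) fun k hk a ha => ?_
    rw [← single_lie_single_swap hk, toEnd_lie]
    have := sub_mem (h1 hk (h1 hk.symm ha)) (h1 hk.symm (h1 hk ha))
    convert this using 1
    noncomm_ring
  exact (hD ▸ Submodule.mem_top : Y ∈ D) a ha

/-- `E_{ij}` is of the form `r uᵀ`. -/
lemma rankOne_single {i j : Fin (N + 1)} (hij : i ≠ j) (c : ℤ)
    (h : toC (Pi.single j 1) ⬝ᵥ toC (Pi.single i c : Fin (N + 1) → ℤ) = 0) :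
    rankOne (toC (Pi.single j 1)) (Pi.single i c) h = single i j hij (c : ℂ) := by
  apply Subtype.ext
  change Matrix.vecMulVec _ _ = Matrix.single i j (c : ℂ)
  ext a b
  rw [Matrix.vecMulVec_apply, Matrix.single_apply]
  clear h
  rcases eq_or_ne i a with rfl | ha <;> rcases eq_or_ne j b with rfl | hb <;>
    simp_all [eq_comm]

lemma dot_single {i j : Fin (N + 1)} (hij : i ≠ j) (c : ℤ) :
    toC (Pi.single j 1) ⬝ᵥ toC (Pi.single i c : Fin (N + 1) → ℤ) = 0 := by
  refine Finset.sum_eq_zero fun a _ => ?_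
  rcases eq_or_ne a i with rfl | ha <;> simp [*]

lemma single_sq_mem {i j : Fin (N + 1)} (hij : i ≠ j) :
    LieModule.toEnd ℂ (SL N) V (single i j hij 1) * LieModule.toEnd ℂ (SL N) V (single i j hij 1) ∈
      squareAlgebra (N := N) V :=
  Algebra.subset_adjoin ⟨_, _, dot_single hij 1, by rw [rankOne_single hij, Int.cast_one]⟩

/-- If `[Z, e] = c e`, then `[Z, Y] e² = [Z, Y e²] - 2c Y e²`. So the set of good `Y` is stable
under the normalizer of `ℂ e`, and only `Y = E_{ji}` needs the `𝔰𝔩₂` identity. -/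
lemma mul_single_sq_mem {i j : Fin (N + 1)} (hij : i ≠ j) (Y : SL N) :
    LieModule.toEnd ℂ (SL N) V Y * (LieModule.toEnd ℂ (SL N) V (single i j hij 1) *
      LieModule.toEnd ℂ (SL N) V (single i j hij 1)) ∈ squareAlgebra (N := N) V := by
  set e := LieModule.toEnd ℂ (SL N) V (single i j hij 1) with he
  have hee : e * e ∈ squareAlgebra (N := N) V := single_sq_mem hij
  let D : Submodule ℂ (SL N) :=
    { carrier := {Y | LieModule.toEnd ℂ (SL N) V Y * (e * e) ∈ squareAlgebra (N := N) V}
      add_mem' := fun {X Y} hX hY => by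
        have := (squareAlgebra (N := N) V).add_mem hX hY
        rwa [← add_mul, ← map_add] at this
      zero_mem' := by simp
      smul_mem' := fun c X hX => by
        have := (squareAlgebra (N := N) V).smul_mem hX c
        rwa [← smul_mul_assoc, ← map_smul] at this }
  suffices D = ⊤ from (this ▸ Submodule.mem_top : Y ∈ D)
  refine eq_top_of_normalizer_stable hij ?_ ?_
  · have h1 := congrArg (LieModule.toEnd ℂ (SL N) V) (single_lie_single_swap hij)
    have h2 := congrArg (LieModule.toEnd ℂ (SL N) V) (singleSubSingle_lie_single hij)
    have h3 := congrArg (LieModule.toEnd ℂ (SL N) V) (singleSubSingle_lie_single hij.symm)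
    have h4 : (singleSubSingle j i (1 : ℂ) : SL N) = - singleSubSingle i j 1 :=
      Subtype.ext (by simp)
    rw [h4] at h3
    rw [toEnd_lie] at h1 h2 h3
    rw [map_smul] at h2 h3
    rw [map_neg] at h3
    rw [← he] at h1 h2
    refine mul_sq_mem_of_sl2 (squareAlgebra (N := N) V)
      (h := LieModule.toEnd ℂ (SL N) V (singleSubSingle i j 1)) ?_ ?_ ?_
      (fun a ha => squareAlgebra_adStable _ ha) hee
    · rw [← h1]; abel
    · rw [two_mul, ← two_smul ℂ e, ← h2]; abel
    · rw [two_mul, ← two_smul ℂ (LieModule.toEnd ℂ (SL N) V _), ← h3]; noncomm_ring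
  · rintro Z Y hY ⟨c, hc⟩
    have hc' := congrArg (LieModule.toEnd ℂ (SL N) V) hc
    rw [toEnd_lie, map_smul, ← he] at hc'
    change LieModule.toEnd ℂ (SL N) V ⁅Z, Y⁆ * (e * e) ∈ squareAlgebra (N := N) V
    have h1 := sub_mem (squareAlgebra_adStable Z hY)
      ((squareAlgebra (N := N) V).smul_mem hY (2 * c))
    convert h1 using 1
    rw [toEnd_lie]
    generalize LieModule.toEnd ℂ (SL N) V Z = z at *
    generalize LieModule.toEnd ℂ (SL N) V Y = y at *
    have : (2 * c) • (y * (e * e)) = y * ((c • e) * e + e * (c • e)) := by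
      rw [smul_mul_assoc, mul_smul_comm, ← two_smul ℂ (c • (e * e)), smul_smul, mul_smul_comm]
    rw [this, ← hc']
    noncomm_ring

/-- Unless the highest weight is zero or fundamental, `E_{N+1,1}²` acts nontrivially. -/
lemma single_sq_ne_zero {C : DominantWeight N} (hN : (0 : Fin (N + 1)) ≠ Fin.last N)
    (hC0 : C ≠ 0) (hC : ∀ k : Fin N, C ≠ fundamentalWeight k) {v : V}
    (hv : IsHighestWeightVector C v) :
    LieModule.toEnd ℂ (SL N) V (single (Fin.last N) 0 hN.symm 1) *
      LieModule.toEnd ℂ (SL N) V (single (Fin.last N) 0 hN.symm 1) ≠ 0 := by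
  obtain ⟨hv0, hvE, hvH⟩ := hv
  have hH (k : Fin (N + 1)) : ⁅(singleSubSingle 0 k (1 : ℂ) : SL N), v⁆ =
      (∑ i : Fin N with i.castSucc < k, (C i : ℂ)) • v := by
    induction k using Fin.induction with
    | zero =>
      have : (singleSubSingle 0 0 (1 : ℂ) : SL N) = 0 := Subtype.ext (by simp)
      simp [this]
    | succ k ih =>
      rw [← singleSubSingle_add_singleSubSingle 0 k.castSucc k.succ, add_lie, ih, hvH k, ← add_smul]
      congr 1
      have : (Finset.univ.filter fun i : Fin N => i.castSucc < k.succ) =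
          insert k (Finset.univ.filter fun i : Fin N => i.castSucc < k.castSucc) := by
        ext i
        simp only [Finset.mem_filter, Finset.mem_univ, true_and, Finset.mem_insert, Fin.lt_def,
          Fin.ext_iff, Fin.val_castSucc, Fin.val_succ]
        omega
      rw [this, Finset.sum_insert (by simp), add_comm]
  -- The sum is the value of the weight on the coroot of the highest root.
  have hm : 2 ≤ ∑ i, C i := by
    by_contra! h
    obtain ⟨k, hk⟩ := Function.ne_iff.1 hC0
    refine hC k (funext fun l => ?_)
    have hk1 : C k ≤ ∑ i, C i := Finset.single_le_sum (fun _ _ => Nat.zero_le _) (Finset.mem_univ k)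
    have hk' : C k ≠ 0 := hk
    rcases eq_or_ne l k with rfl | hl
    · simp only [fundamentalWeight, Pi.single_eq_same]
      omega
    · simp only [fundamentalWeight, Pi.single_eq_of_ne hl]
      have h3 := Finset.sum_le_sum_of_subset (f := C) (Finset.subset_univ {k, l})
      rw [Finset.sum_pair hl.symm] at h3
      omega
  have hHv := hH (Fin.last N)
  simp only [Fin.castSucc_lt_last, Finset.filter_true] at hHv
  rw [← Nat.cast_sum] at hHv
  generalize ∑ i, C i = m at hm hHv
  have hev := hvE 0 (Fin.last N) (Fin.pos_iff_ne_zero.2 hN.symm)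
  have hef := single_lie_single_swap hN
  have h3 := singleSubSingle_lie_single hN.symm
  have h4 : (singleSubSingle (Fin.last N) 0 (1 : ℂ) : SL N) = - singleSubSingle 0 (Fin.last N) 1 :=
    Subtype.ext (by simp)
  rw [h4, neg_lie] at h3
  set e : SL N := single 0 (Fin.last N) hN 1
  set f : SL N := single (Fin.last N) 0 hN.symm 1
  set h : SL N := singleSubSingle 0 (Fin.last N) 1
  have hhf : ⁅h, f⁆ = (-2 : ℂ) • f := by rw [neg_smul, ← h3, neg_neg]
  intro h0
  have hff : ⁅f, ⁅f, v⁆⁆ = 0 := congrArg (fun F => F v) h0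
  have e1 : ⁅e, ⁅f, v⁆⁆ = (m : ℂ) • v := by rw [leibniz_lie, hef, hev, lie_zero, add_zero, hHv]
  -- The usual `𝔰𝔩₂` computation: `e² f² v = m (2m - 2) v`, nonzero for `m ≥ 2`.
  have e2 : ⁅e, ⁅f, ⁅f, v⁆⁆⁆ = (2 * m - 2 : ℂ) • ⁅f, v⁆ := by
    rw [leibniz_lie, hef, e1, leibniz_lie, hhf, hHv, smul_lie, lie_smul]
    module
  have e3 : ⁅e, ⁅e, ⁅f, ⁅f, v⁆⁆⁆⁆ = ((2 * m - 2) * m : ℂ) • v := by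
    rw [e2, lie_smul, e1, smul_smul]
  rw [hff, lie_zero, lie_zero] at e3
  have hm1 : (m : ℂ) ≠ 0 := by exact_mod_cast (by omega : m ≠ 0)
  have hm2 : (m : ℂ) ≠ 1 := by exact_mod_cast (by omega : m ≠ 1)
  refine smul_ne_zero (mul_ne_zero ?_ hm1) hv0 e3.symm
  intro h5
  apply hm2
  linear_combination h5 / 2

/-- No `E_{ij}` acts as a scalar. -/
lemma toEnd_single_ne_algebraMap [LieModule.IsIrreducible ℂ (SL N) V]
    (hne : LieModule.toEnd ℂ (SL N) V ≠ 0) {i j : Fin (N + 1)} (hij : i ≠ j) (c : ℂ) :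
    LieModule.toEnd ℂ (SL N) V (single i j hij 1) ≠ algebraMap ℂ _ c := by
  intro h
  -- A scalar is central, so the coroot acts as zero and hence so does `E_{ji}`. The kernel of the
  -- action is an ideal, so it would be everything.
  have hH : LieModule.toEnd ℂ (SL N) V (singleSubSingle i j 1) = 0 := by
    rw [← single_lie_single_swap hij, toEnd_lie, h, Algebra.commutes, sub_self]
  have hf : LieModule.toEnd ℂ (SL N) V (single j i hij.symm 1) = 0 := by
    have h4 : (singleSubSingle j i (1 : ℂ) : SL N) = - singleSubSingle i j 1 :=
      Subtype.ext (by simp)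
    have h3 := congrArg (LieModule.toEnd ℂ (SL N) V) (singleSubSingle_lie_single hij.symm)
    rw [toEnd_lie, h4, map_neg, hH, map_smul] at h3
    simpa using h3.symm
  have hD : LinearMap.ker (LieModule.toEnd ℂ (SL N) V : SL N →ₗ[ℂ] Module.End ℂ V) = ⊤ := by
    refine eq_top_of_normalizer_stable hij hf fun Z Y hY _ => ?_
    have hY' : LieModule.toEnd ℂ (SL N) V Y = 0 := hY
    change LieModule.toEnd ℂ (SL N) V ⁅Z, Y⁆ = 0
    rw [toEnd_lie, hY', mul_zero, zero_mul, sub_self]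
  refine hne (LieHom.ext fun Y => ?_)
  exact (hD ▸ Submodule.mem_top : Y ∈ LinearMap.ker (LieModule.toEnd ℂ (SL N) V :
    SL N →ₗ[ℂ] Module.End ℂ V))

end SquareAlgebra

/-! ### Graded components of submodules -/

section Graded

variable {N : ℕ} {σ : Fin (N + 1) → ℂ} {V : Type*} [AddCommGroup V] [Module ℂ V]

variable (σ V) in
/-- The embedding `v ↦ v ⊗ q^n`. -/
def eltLin (n : Fin (N + 1) → ℤ) : V →ₗ[ℂ] TensorModule σ V :=
  (TensorProduct.mk ℂ V (Laurent N)).flip (mono n)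

lemma eltLin_injective (n : Fin (N + 1) → ℤ) : Function.Injective (eltLin σ V n) := by
  let g : V ⊗[ℂ] Laurent N →ₗ[ℂ] V := (TensorProduct.rid ℂ V).toLinearMap ∘ₗ
    TensorProduct.map LinearMap.id
      (Finsupp.lapply n ∘ₗ (AddMonoidAlgebra.coeffLinearEquiv ℂ).toLinearMap)
  refine Function.LeftInverse.injective (g := g) fun v => ?_
  change g (v ⊗ₜ mono n) = v
  simp [g, mono]

/-- Every element is a sum of homogeneous elements. -/
lemma exists_eq_sum_eltLin (w : TensorModule σ V) :
    ∃ f : (Fin (N + 1) → ℤ) →₀ V, w = f.sum fun n v => eltLin σ V n v := by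
  let T : ((Fin (N + 1) → ℤ) →₀ V) →ₗ[ℂ] V ⊗[ℂ] Laurent N := Finsupp.lsum ℂ (eltLin σ V)
  have hT : LinearMap.range T = ⊤ := by
    refine LinearMap.range_eq_top.2 fun w => ?_
    have : (LinearMap.range T).mkQ = 0 := by
      refine tensor_hom_ext fun v n => ?_
      rw [Submodule.mkQ_apply, LinearMap.zero_apply, Submodule.Quotient.mk_eq_zero]
      exact ⟨Finsupp.single n v, (Finsupp.lsum_single ℂ _ _ _)⟩
    have h := congrArg (fun F => F w) this
    rw [Submodule.mkQ_apply, LinearMap.zero_apply, Submodule.Quotient.mk_eq_zero] at h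
    exact h
  obtain ⟨f, hf⟩ := LinearMap.range_eq_top.1 hT w
  exact ⟨f, hf.symm⟩

variable [LieRingModule (SL N) V] [LieModule ℂ (SL N) V]

lemma dvf_lie_eltLin (u : Fin (N + 1) → ℂ) (r : Fin (N + 1) → ℤ) (h : u ⬝ᵥ toC r = 0)
    (v : V) (n : Fin (N + 1) → ℤ) :
    ⁅dvf u r h, eltLin σ V n v⁆ =
      eltLin σ V (n + r) ((u ⬝ᵥ (toC n + σ)) • v + ⁅rankOne u r h, v⁆) := by
  rw [map_add, map_smul]
  exact dvf_lie_elt σ V u r h v n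

/-- The degree `n` component of a submodule of `F^σ(V)`. -/
def component (M : LieSubmodule ℂ (DDiv N) (TensorModule σ V)) (n : Fin (N + 1) → ℤ) :
    Submodule ℂ V := M.toSubmodule.comap (eltLin σ V n)

lemma mem_component {M : LieSubmodule ℂ (DDiv N) (TensorModule σ V)} {n : Fin (N + 1) → ℤ} {v : V} :
    v ∈ component M n ↔ eltLin σ V n v ∈ M := Iff.rfl

lemma zero_dvf_lie_eltLin (j : Fin (N + 1)) (v : V) (n : Fin (N + 1) → ℤ) :
    ⁅dvf (Pi.single j 1) 0 (by simp [dotProduct]), eltLin σ V n v⁆ =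
      eltLin σ V n ((n j + σ j : ℂ) • v) := by
  rw [dvf_lie_eltLin]
  have : rankOne (Pi.single j 1) (0 : Fin (N + 1) → ℤ) (by simp [dotProduct]) = 0 := by
    apply Subtype.ext
    rw [rankOne_val]
    ext a b
    simp [Matrix.vecMulVec_apply]
  rw [this]
  simp

/-- Submodules of `F^σ(V)` are graded. -/
lemma mem_component_of_sum_mem (M : LieSubmodule ℂ (DDiv N) (TensorModule σ V))
    (F : Finset (Fin (N + 1) → ℤ)) {m : Fin (N + 1) → ℤ} (hm : m ∉ F)
    (v : (Fin (N + 1) → ℤ) → V) (h : eltLin σ V m (v m) + ∑ n ∈ F, eltLin σ V n (v n) ∈ M) :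
    v m ∈ component M m := by
  induction F using Finset.induction_on generalizing v with
  | empty => simpa [mem_component] using h
  | insert a F ha ih =>
    rw [Finset.mem_insert, not_or] at hm
    obtain ⟨j, hj⟩ := Function.ne_iff.1 hm.1
    set w := eltLin σ V m (v m) + ∑ n ∈ insert a F, eltLin σ V n (v n) with hw
    -- Subtracting the eigenvalue in degree `a` removes that term and scales the degree `m` term by
    -- `m j - a j ≠ 0`.
    have h2 : ⁅dvf (Pi.single j 1) 0 (by simp [dotProduct]), w⁆ - (a j + σ j : ℂ) • w ∈ M :=
      sub_mem (M.lie_mem h) (M.smul_mem _ h)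
    have h3 := ih hm.2 (fun n => (n j - a j : ℂ) • v n) (by
      convert h2 using 1
      rw [hw, Finset.sum_insert ha, lie_add, lie_add, lie_sum, smul_add, smul_add, Finset.smul_sum]
      simp only [zero_dvf_lie_eltLin]
      have e : ∀ n, eltLin σ V n ((n j - a j : ℂ) • v n) =
          eltLin σ V n ((n j + σ j : ℂ) • v n) - (a j + σ j : ℂ) • eltLin σ V n (v n) := by
        intro n
        rw [← map_smul, ← map_sub, ← sub_smul]
        congr 2
        ring
      simp only [e, Finset.sum_sub_distrib, map_smul]
      abel)
    refine ((component M m).smul_mem_iff (sub_ne_zero.2 ?_)).1 h3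
    exact_mod_cast hj

lemma exists_component_ne_bot {M : LieSubmodule ℂ (DDiv N) (TensorModule σ V)} (hM : M ≠ ⊥) :
    ∃ n, component M n ≠ ⊥ := by
  by_contra! h
  refine hM ((LieSubmodule.eq_bot_iff _).2 fun w hw => ?_)
  obtain ⟨f, rfl⟩ := exists_eq_sum_eltLin w
  refine Finset.sum_eq_zero fun n hn => ?_
  have := mem_component_of_sum_mem M (f.support.erase n) (Finset.notMem_erase n _) f (by
    rwa [Finset.add_sum_erase _ (fun n => eltLin σ V n (f n)) hn])
  rw [h n, Submodule.mem_bot] at this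
  rw [this]
  exact map_zero _

lemma eq_top_of_component_eq_top {M : LieSubmodule ℂ (DDiv N) (TensorModule σ V)}
    (h : ∀ n, component M n = ⊤) : M = ⊤ := by
  refine top_le_iff.1 fun w _ => ?_
  obtain ⟨f, rfl⟩ := exists_eq_sum_eltLin w
  exact Submodule.sum_mem M.toSubmodule fun n _ => mem_component.1 (h n ▸ Submodule.mem_top)

lemma rankOne_neg {u : Fin (N + 1) → ℂ} {r : Fin (N + 1) → ℤ} (h : u ⬝ᵥ toC r = 0)
    (h' : u ⬝ᵥ toC (-r) = 0) : rankOne u (-r) h' = -rankOne u r h := by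
  apply Subtype.ext
  rw [NegMemClass.coe_neg, rankOne_val, rankOne_val]
  ext a b
  simp [Matrix.vecMulVec_apply]

/-- The components of a submodule are stable under the squares of the operators `r uᵀ`. -/
lemma squareAlgebra_component (M : LieSubmodule ℂ (DDiv N) (TensorModule σ V))
    (n : Fin (N + 1) → ℤ) {a : Module.End ℂ V} (ha : a ∈ squareAlgebra (N := N) V) :
    ∀ v ∈ component M n, a v ∈ component M n := by
  induction ha using Algebra.adjoin_induction with
  | mem x hx =>
    obtain ⟨u, r, h, rfl⟩ := hx
    intro v hv
    have h' : toC u ⬝ᵥ toC (-r) = 0 := by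
      have : toC (-r) = -toC r := by ext; simp
      rw [this, dotProduct_neg, h, neg_zero]
    -- Since `(u|r) = 0`, the same scalar `α = (u|n + σ)` occurs in both factors, and the composite
    -- is `(α - P)(α + P) = α² - P²`.
    have h1 := M.lie_mem (x := dvf (toC u) (-r) h') (M.lie_mem (x := dvf (toC u) r h) hv)
    rw [dvf_lie_eltLin, dvf_lie_eltLin, rankOne_neg h, add_neg_cancel_right, toC_add, add_right_comm,
      dotProduct_add _ _ (toC r), h, add_zero] at h1
    have h2 := (component M n).smul_mem ((toC u ⬝ᵥ (toC n + σ)) ^ 2) hv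
    have h3 := (component M n).sub_mem h2 (mem_component.2 h1)
    convert h3 using 1
    rw [Module.End.mul_apply, LieModule.toEnd_apply_apply, LieModule.toEnd_apply_apply, neg_lie,
      lie_add, lie_smul]
    module
  | algebraMap c => exact fun v hv => (component M n).smul_mem c hv
  | add x y _ _ ihx ihy => exact fun v hv => (component M n).add_mem (ihx v hv) (ihy v hv)
  | mul x y _ _ ihx ihy => exact fun v hv => ihx _ (ihy v hv)

/-- A full component has nonzero neighbours. -/
lemma component_add_single_ne_bot [LieModule.IsIrreducible ℂ (SL N) V]
    (hne : LieModule.toEnd ℂ (SL N) V ≠ 0) (M : LieSubmodule ℂ (DDiv N) (TensorModule σ V))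
    {n : Fin (N + 1) → ℤ} (hn : component M n = ⊤) {i j : Fin (N + 1)} (hij : i ≠ j) {c : ℤ}
    (hc : c ≠ 0) : component M (n + Pi.single i c) ≠ ⊥ := by
  intro h
  set d : ℂ := toC (Pi.single j 1) ⬝ᵥ (toC n + σ)
  have hc' : (c : ℂ) ≠ 0 := by exact_mod_cast hc
  -- If the neighbour vanished, `D(e_j, c e_i)` would kill every `v ⊗ q^n`, that is, `d v + c E_{ij}
  -- v = 0`.
  refine toEnd_single_ne_algebraMap hne hij (-(c : ℂ)⁻¹ * d) (LinearMap.ext fun v => ?_)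
  have h1 : ⁅dvf _ _ (dot_single hij c), eltLin σ V n v⁆ ∈ M :=
    M.lie_mem (mem_component.1 (hn ▸ Submodule.mem_top : v ∈ component M n))
  rw [dvf_lie_eltLin, ← mem_component, h, Submodule.mem_bot, rankOne_single hij] at h1
  have hs : (single i j hij (c : ℂ) : SL N) = (c : ℂ) • single i j hij 1 := by
    rw [← map_smul, smul_eq_mul, mul_one]
  rw [hs, smul_lie] at h1
  rw [LieModule.toEnd_apply_apply, Module.algebraMap_end_apply]
  have h2 := congrArg (fun x => (c : ℂ)⁻¹ • x) (eq_neg_of_add_eq_zero_right h1)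
  simp only [inv_smul_smul₀ hc'] at h2
  rw [h2, smul_neg, smul_smul, neg_mul, neg_smul]

end Graded

end TorusFields

end

/-! ### Irreducibility of the tensor module -/

theorem mainTheorem1 (N : ℕ) (hN : 1 ≤ N) (C : TorusFields.DominantWeight N)
    (hC0 : C ≠ 0) (hC : ∀ k : Fin N, C ≠ TorusFields.fundamentalWeight k)
    (V : Type*) [AddCommGroup V] [Module ℂ V] [LieRingModule (TorusFields.SL N) V]
    [LieModule ℂ (TorusFields.SL N) V] (hV : TorusFields.IsIrreducibleOfHighestWeight C V)
    (σ : Fin (N + 1) → ℂ) :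
    LieModule.IsIrreducible ℂ (TorusFields.DDiv N) (TorusFields.TensorModule σ V) := by
  open TorusFields in
  obtain ⟨hfin, hirr, v, hv⟩ := hV
  have h0N : (0 : Fin (N + 1)) ≠ Fin.last N := by
    rw [Ne, Fin.ext_iff, Fin.val_zero, Fin.val_last]
    omega
  have hsq := single_sq_ne_zero h0N hC0 hC hv
  have hne : LieModule.toEnd ℂ (SL N) V ≠ 0 := fun h => hsq (by simp [h])
  have hcomp (M : LieSubmodule ℂ (DDiv N) (TensorModule σ V)) (n) (h : component M n ≠ ⊥) :
      component M n = ⊤ :=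
    eq_top_of_adStable (L := SL N) (squareAlgebra (N := N) V)
      (fun Y _ ha => squareAlgebra_adStable Y ha) hsq (single_sq_mem _) (mul_single_sq_mem _)
      (fun _ ha => squareAlgebra_component M n ha) h
  have : Nontrivial (TensorModule σ V) :=
    ⟨eltLin σ V 0 v, 0, fun h => hv.1 (eltLin_injective 0 (h.trans (map_zero _).symm))⟩
  refine LieModule.IsIrreducible.mk fun M hM => eq_top_of_component_eq_top fun m => ?_
  obtain ⟨n, hn⟩ := exists_component_ne_bot hM
  have hstep (n : Fin (N + 1) → ℤ) (hn : component M n = ⊤) (i : Fin (N + 1)) {c : ℤ} (hc : c ≠ 0) :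
      component M (n + Pi.single i c) = ⊤ := by
    obtain ⟨j, hj⟩ : ∃ j, i ≠ j := by
      rcases eq_or_ne i 0 with rfl | hi
      · exact ⟨_, h0N⟩
      · exact ⟨_, hi⟩
    exact hcomp M _ (component_add_single_ne_bot hne M hn hj hc)
  -- Fullness travels from `n` to `m` by changing one coordinate at a time.
  have hsum (s : Finset (Fin (N + 1))) : component M (n + ∑ i ∈ s, Pi.single i ((m - n) i)) = ⊤ := by
    induction s using Finset.induction_on with
    | empty => simpa using hcomp M n hn
    | insert i s hi ih =>
      rw [Finset.sum_insert hi, add_comm (Pi.single i _), ← add_assoc]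
      rcases eq_or_ne ((m - n) i) 0 with h | h
      · rwa [h, Pi.single_zero, add_zero]
      · exact hstep _ ih i h
  have := hsum Finset.univ
  rwa [Finset.univ_sum_single, add_sub_cancel] at this
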